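/- Let $\mathcal L:\mathbb R^d\to\mathbb R$ be differentiable and, for constants $L<\infty$ and $\mu>0$ and all $\theta,\theta'\in\mathbb R^d$, satisfy $$\mathcal L(\theta)+\langle\nabla\mathcal L(\theta),\theta'-\theta\rangle+\tfrac{\mu}{2}\|\theta-\theta'\|^2\le\mathcal L(\theta')\le\mathcal L(\theta)+\langle\nabla\mathcal L(\theta),\theta'-\theta\rangle+\tfrac{L}{2}\|\theta-\theta'\|^2 ,$$ and let $\theta^\star$ be its minimizer. Let $\Theta\subset\mathbb R^d$ be a closed, bounded, convex set containing $\theta^\star$, with diameter $D$ and Euclidean projection $\Pi_\Theta$. For each $\theta$ let $\mathcal D_{\mathcal I}(\theta)$ (law of the uncorrupted gradient sample $\widetilde G(\theta)$) and $\mathcal D_{\mathcal O}(\theta)$ (arbitrary law of the corrupted sample) be probability measures on $\mathbb R^d$ depending measurably on $\theta$. Write $\widetilde G(\theta)=\nabla\mathcal L(\theta)+\varepsilon_\theta$ and assume: (i) $\mathbb E\,\varepsilon_\theta=0$, and there are $\delta\in(0,1]$ and a function $\varkappa:(0,\infty)\to(0,\infty)$, both independent of $\theta$, such that for every $\theta$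 the law of $\varepsilon_\theta$ is $\delta\nu_{\theta,1}+(1-\delta)\nu_{\theta,2}$ with probability measures $\nu_{\theta,1},\nu_{\theta,2}$, where $\nu_{\theta,1}$ has a Lebesgue density $h_\theta$ with $\inf_{\|\omega\|\le R}h_\theta(\omega)>\varkappa(R)$ for all $R>0$; (ii) there are $q>1$ and $A_q,B_q>0$ with $\mathbb E[\|\varepsilon_\theta\|^q]^{1/q}\le A_q\|\theta-\theta^\star\|+B_q$ for all $\theta$. Let $\eta\in[0,1/2)$ be the corruption rate, $p\in(0,1)$ with $\eta\le p\le 1-\eta$, and $\beta>0$ the step size. Let $\tau_\theta=\inf\{t:\mathbb P(\|\widetilde G(\theta)\|\le t)\ge p\}$ be the $p$-th quantile of $\|\widetilde G(\theta)\|$. Projected quantile-clipped SGD is the Markov chain that, from $\theta$, draws $G$ from the mixture $\eta\,\mathcal D_{\mathcal O}(\theta)+(1-\eta)\,\mathcal D_{\mathcal I}(\theta)$ and moves to $\Pi_\Theta\big(\theta-\beta\min(1,\tau_\theta/\|G\|)\,G\big)$. Put $\overline\tau=\sup_{\theta\in\Theta}\tau_\theta$, $\overline B_q=A_qD+B_q$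 and assume $$\kappa:=(1-\eta)p\mu-\eta L-(1-p)^{-1/q}A_q\big(1-p(1-\eta)\big)>0 .$$ Let $\pi_{\beta,p}$ be an invariant probability measure of this chain and $\theta\sim\pi_{\beta,p}$. 1. If $\eta=0$, $\beta<\frac14\,\frac{\kappa}{\mu^2+6L^2}$ and $p\ge 1-(\beta\mu)^{\frac{q}{2(q-1)}}$, then $X=\|\theta-\theta^\star\|$ is $K$-sub-Gaussian, i.e. $\mathbb E\exp(\lambda^2X^2)\le e^{\lambda^2K^2}$ for all $|\lambda|\le 1/K$, with $$K=4\sqrt{\frac{2\beta(\overline B_q^2+\overline\tau^2)}{p\mu}}>0 .$$ 2. If $\eta>0$ and $\beta<\frac14\,\frac{\kappa}{\mu^2+6L^2+16\eta^{-2/q}A_q^2}$, then $X=\|\theta-\theta^\star\|$ is $K$-sub-exponential, i.e. $\mathbb E\exp(\lambda|X|)\le e^{\lambda K}$ for all $0\le\lambda\le 1/K$, with $$K=\frac{7\overline\tau+(1-p)^{1-1/q}\,\overline B_q}{p\mu}>0 .$$ -/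

import Mathlib

open MeasureTheory ProbabilityTheory Set
open scoped ENNReal Gradient

/-! ### Sub-Gaussian and sub-exponential variables -/

/-- `X` is `K`-sub-Gaussian under `P`:
`K > 0` and `𝔼 exp (s² X²) ≤ exp (s² K²)` for all `|s| ≤ 1 / K`. -/
def IsSubGaussian {Ω : Type*} [MeasurableSpace Ω] (K : ℝ) (X : Ω → ℝ) (P : Measure Ω) : Prop :=
  0 < K ∧ ∀ s : ℝ, |s| ≤ 1 / K →
    Integrable (fun ω => Real.exp (s ^ 2 * X ω ^ 2)) P ∧
      ∫ ω, Real.exp (s ^ 2 * X ω ^ 2) ∂P ≤ Real.exp (s ^ 2 * K ^ 2)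

/-- `X` is `K`-sub-exponential under `P`:
`K > 0` and `𝔼 exp (s |X|) ≤ exp (s K)` for all `0 ≤ s ≤ 1 / K`. -/
def IsSubExponential {Ω : Type*} [MeasurableSpace Ω] (K : ℝ) (X : Ω → ℝ) (P : Measure Ω) : Prop :=
  0 < K ∧ ∀ s : ℝ, 0 ≤ s → s ≤ 1 / K →
    Integrable (fun ω => Real.exp (s * |X ω|)) P ∧
      ∫ ω, Real.exp (s * |X ω|) ∂P ≤ Real.exp (s * K)

/-! ### Assumptions on the objective and on the gradient samples -/

section Assumptions

variable {d : ℕ}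

/-- `𝓛` is differentiable and `L`-smooth: the quadratic upper bound holds everywhere. -/
def IsLSmooth (𝓛 : EuclideanSpace ℝ (Fin d) → ℝ) (L : ℝ) : Prop :=
  Differentiable ℝ 𝓛 ∧ ∀ θ θ' : EuclideanSpace ℝ (Fin d),
    𝓛 θ' ≤ 𝓛 θ + inner ℝ (∇ 𝓛 θ) (θ' - θ) + L / 2 * ‖θ - θ'‖ ^ 2

/-- `𝓛` is `μ`-strongly convex, with `μ > 0`: the quadratic lower bound holds everywhere. -/
def IsMuStronglyConvex (𝓛 : EuclideanSpace ℝ (Fin d) → ℝ) (μ : ℝ) : Prop :=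
  0 < μ ∧ ∀ θ θ' : EuclideanSpace ℝ (Fin d),
    𝓛 θ + inner ℝ (∇ 𝓛 θ) (θ' - θ) + μ / 2 * ‖θ - θ'‖ ^ 2 ≤ 𝓛 θ'

/-- The law of the gradient noise `ε_θ = G̃(θ) - ∇𝓛(θ)` when `G̃(θ)` has law `DI θ`. -/
noncomputable def noiseLaw (𝓛 : EuclideanSpace ℝ (Fin d) → ℝ)
    (DI : Kernel (EuclideanSpace ℝ (Fin d)) (EuclideanSpace ℝ (Fin d)))
    (θ : EuclideanSpace ℝ (Fin d)) : Measure (EuclideanSpace ℝ (Fin d)) :=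
  (DI θ).map (fun g => g - ∇ 𝓛 θ)

/-- The noise is centered, and its law is a mixture `δ ν₁ + (1 - δ) ν₂` with `δ > 0` where `ν₁`
has a Lebesgue density which on every ball of radius `R` around the origin stays above a positive
level `ϰ R` that does not depend on `θ`. -/
def IsCenteredDiffuse (𝓛 : EuclideanSpace ℝ (Fin d) → ℝ)
    (DI : Kernel (EuclideanSpace ℝ (Fin d)) (EuclideanSpace ℝ (Fin d))) : Prop :=
  (∀ θ, Integrable (fun e => e) (noiseLaw 𝓛 DI θ) ∧ ∫ e, e ∂(noiseLaw 𝓛 DI θ) = 0) ∧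
  ∃ (δ : ℝ) (ϰ : ℝ → ℝ), 0 < δ ∧ δ ≤ 1 ∧ (∀ R, 0 < R → 0 < ϰ R) ∧
    ∀ θ, ∃ (ν₁ ν₂ : Measure (EuclideanSpace ℝ (Fin d)))
      (h : EuclideanSpace ℝ (Fin d) → ℝ≥0∞),
      IsProbabilityMeasure ν₁ ∧ IsProbabilityMeasure ν₂ ∧
      noiseLaw 𝓛 DI θ = ENNReal.ofReal δ • ν₁ + ENNReal.ofReal (1 - δ) • ν₂ ∧
      Measurable h ∧ ν₁ = volume.withDensity h ∧
      ∀ R, 0 < R → ENNReal.ofReal (ϰ R) < ⨅ ω ∈ Metric.closedBall 0 R, h ω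

/-- The noise has a finite moment of order `q`, and
`(𝔼 ‖ε_θ‖ ^ q) ^ (1 / q) ≤ A ‖θ - θ⋆‖ + B` for all `θ`. -/
def HasMomentBound (𝓛 : EuclideanSpace ℝ (Fin d) → ℝ)
    (DI : Kernel (EuclideanSpace ℝ (Fin d)) (EuclideanSpace ℝ (Fin d)))
    (θstar : EuclideanSpace ℝ (Fin d)) (q A B : ℝ) : Prop :=
  1 < q ∧ 0 < A ∧ 0 < B ∧ ∀ θ,
    Integrable (fun e => ‖e‖ ^ q) (noiseLaw 𝓛 DI θ) ∧
      (∫ e, ‖e‖ ^ q ∂(noiseLaw 𝓛 DI θ)) ^ (1 / q) ≤ A * ‖θ - θstar‖ + B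

end Assumptions

/-- The quantity `(1-η) p μ - η L - (1-p)^(-1/q) A (1 - p (1-η))`. -/
noncomputable def kappa (η p μ L q A : ℝ) : ℝ :=
  (1 - η) * p * μ - η * L - (1 - p) ^ (-1 / q) * A * (1 - p * (1 - η))

/-! ### Quantiles, clipping, projection -/

/-- The `p`-th quantile `inf {t | ν (-∞, t] ≥ p}` of a probability measure on the line. -/
noncomputable def quantile (p : ℝ) (ν : Measure ℝ) : ℝ := sInf {t : ℝ | p ≤ ν.real (Iic t)}

/-- Clipping: `min (1, t / ‖g‖) g`. -/
noncomputable def clip {E : Type*} [NormedAddCommGroup E] [NormedSpace ℝ E] (t : ℝ) (g : E) : E :=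
  min 1 (t / ‖g‖) • g

section Projection

variable {d : ℕ}

theorem exists_nearest (Θ : ConvexBody (EuclideanSpace ℝ (Fin d)))
    (x : EuclideanSpace ℝ (Fin d)) :
    ∃ v ∈ (Θ : Set (EuclideanSpace ℝ (Fin d))),
      ∀ w ∈ (Θ : Set (EuclideanSpace ℝ (Fin d))), ‖x - v‖ ≤ ‖x - w‖ :=
  Θ.isCompact.exists_isMinOn (f := fun v => ‖x - v‖) Θ.nonempty
    (by fun_prop)

/-- The Euclidean projection onto a nonempty compact convex set: its point nearest to `x`. -/
noncomputable def proj (Θ : ConvexBody (EuclideanSpace ℝ (Fin d)))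
    (x : EuclideanSpace ℝ (Fin d)) : EuclideanSpace ℝ (Fin d) :=
  (exists_nearest Θ x).choose

theorem proj_mem (Θ : ConvexBody (EuclideanSpace ℝ (Fin d))) (x : EuclideanSpace ℝ (Fin d)) :
    proj Θ x ∈ (Θ : Set (EuclideanSpace ℝ (Fin d))) :=
  (exists_nearest Θ x).choose_spec.1

theorem proj_inner_le (Θ : ConvexBody (EuclideanSpace ℝ (Fin d)))
    (x w : EuclideanSpace ℝ (Fin d)) (hw : w ∈ (Θ : Set (EuclideanSpace ℝ (Fin d)))) :
    inner ℝ (x - proj Θ x) (w - proj Θ x) ≤ 0 := by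
  have hmin := (exists_nearest Θ x).choose_spec.2
  have : Nonempty (Θ : Set (EuclideanSpace ℝ (Fin d))) := ⟨⟨_, proj_mem Θ x⟩⟩
  refine (norm_eq_iInf_iff_real_inner_le_zero Θ.convex (proj_mem Θ x)).1 ?_ w hw
  refine le_antisymm (le_ciInf fun w => hmin w w.2) ?_
  exact ciInf_le (f := fun w : (Θ : Set (EuclideanSpace ℝ (Fin d))) => ‖x - w‖)
    ⟨0, by rintro _ ⟨w, rfl⟩; exact norm_nonneg _⟩ ⟨_, proj_mem Θ x⟩

theorem proj_lipschitz (Θ : ConvexBody (EuclideanSpace ℝ (Fin d))) :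
    LipschitzWith 1 (proj Θ) := by
  refine LipschitzWith.of_dist_le_mul fun x y => ?_
  rw [NNReal.coe_one, one_mul, dist_eq_norm, dist_eq_norm]
  have h1 := proj_inner_le Θ x (proj Θ y) (proj_mem Θ y)
  have h2 := proj_inner_le Θ y (proj Θ x) (proj_mem Θ x)
  have h3 : ‖proj Θ x - proj Θ y‖ ^ 2 ≤ inner ℝ (x - y) (proj Θ x - proj Θ y) := by
    rw [← real_inner_self_eq_norm_sq]
    simp only [inner_sub_left, inner_sub_right] at h1 h2 ⊢
    linarith
  have h4 := real_inner_le_norm (x - y) (proj Θ x - proj Θ y)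
  by_contra hlt
  push Not at hlt
  have h5 : 0 ≤ ‖x - y‖ := norm_nonneg _
  nlinarith

end Projection

/-! ### The Markov chain of projected quantile-clipped SGD -/

section Chain

variable {d : ℕ}

/-- The clipping threshold `τ_θ`: the `p`-th quantile of `‖G̃(θ)‖`, where `G̃(θ)` is an uncorrupted
gradient sample, with law `DI θ`. -/
noncomputable def threshold (p : ℝ)
    (DI : Kernel (EuclideanSpace ℝ (Fin d)) (EuclideanSpace ℝ (Fin d)))
    (θ : EuclideanSpace ℝ (Fin d)) : ℝ :=
  quantile p ((DI θ).map (fun g => ‖g‖))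

/-- The law of an `η`-corrupted gradient sample `U Ǧ(θ) + (1 - U) G̃(θ)`, with `U` an independent
Bernoulli variable of parameter `η`, `Ǧ(θ)` of law `DO θ` and `G̃(θ)` of law `DI θ`. -/
noncomputable def sampleKernel (η : ℝ)
    (DI DO : Kernel (EuclideanSpace ℝ (Fin d)) (EuclideanSpace ℝ (Fin d))) :
    Kernel (EuclideanSpace ℝ (Fin d)) (EuclideanSpace ℝ (Fin d)) where
  toFun θ := ENNReal.ofReal η • DO θ + ENNReal.ofReal (1 - η) • DI θ
  measurable' := by
    refine Measure.measurable_of_measurable_coe _ fun s hs => ?_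
    simp only [Measure.coe_add, Measure.coe_smul, Pi.add_apply, Pi.smul_apply, smul_eq_mul]
    exact ((DO.measurable_coe hs).const_mul _).add ((DI.measurable_coe hs).const_mul _)

instance sampleKernel_isFinite (η : ℝ)
    (DI DO : Kernel (EuclideanSpace ℝ (Fin d)) (EuclideanSpace ℝ (Fin d)))
    [IsMarkovKernel DI] [IsMarkovKernel DO] : IsFiniteKernel (sampleKernel η DI DO) :=
  ⟨⟨ENNReal.ofReal η + ENNReal.ofReal (1 - η), by simp, fun θ => by simp [sampleKernel]⟩⟩

/-- One iteration from `θ` with gradient sample `g`: `Π_Θ (θ - β α_θ g)`. -/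
noncomputable def step (β p : ℝ) (Θ : ConvexBody (EuclideanSpace ℝ (Fin d)))
    (DI : Kernel (EuclideanSpace ℝ (Fin d)) (EuclideanSpace ℝ (Fin d)))
    (θ g : EuclideanSpace ℝ (Fin d)) : EuclideanSpace ℝ (Fin d) :=
  proj Θ (θ - β • clip (threshold p DI θ) g)

theorem measurable_threshold (p : ℝ)
    (DI : Kernel (EuclideanSpace ℝ (Fin d)) (EuclideanSpace ℝ (Fin d))) [IsMarkovKernel DI] :
    Measurable (threshold p DI) := by
  set F : EuclideanSpace ℝ (Fin d) → ℝ → ℝ :=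
    fun θ t => ((DI θ).map (fun g => ‖g‖)).real (Iic t) with hF
  have hFm : ∀ t, Measurable fun θ => F θ t := by
    intro t
    have : ∀ θ, F θ t = ((DI θ) ((fun g => ‖g‖) ⁻¹' Iic t)).toReal := by
      intro θ
      rw [hF]
      simp only [Measure.real]
      rw [Measure.map_apply measurable_norm measurableSet_Iic]
    simp only [this]
    exact (DI.measurable_coe (measurable_norm measurableSet_Iic)).ennreal_toReal
  have hmono : ∀ θ, Monotone (F θ) := by
    intro θ s t hst
    have : IsProbabilityMeasure ((DI θ).map (fun g => ‖g‖)) :=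
      Measure.isProbabilityMeasure_map measurable_norm.aemeasurable
    exact measureReal_mono (Iic_subset_Iic.2 hst)
  have hneg : ∀ θ t, t < 0 → F θ t = 0 := by
    intro θ t ht
    rw [hF]
    simp only [Measure.real]
    rw [Measure.map_apply measurable_norm measurableSet_Iic]
    have : ((fun g : EuclideanSpace ℝ (Fin d) => ‖g‖) ⁻¹' Iic t) = ∅ := by
      ext g
      simp only [mem_preimage, mem_Iic, mem_empty_iff_false, iff_false, not_le]
      exact ht.trans_le (norm_nonneg g)
    simp [this]
  have hdef : ∀ θ, threshold p DI θ = sInf {t | p ≤ F θ t} := fun θ => rfl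
  rcases le_or_gt p 0 with hp | hp
  · have : threshold p DI = fun _ => 0 := by
      funext θ
      have : {t | p ≤ F θ t} = univ := by
        ext t
        simp only [mem_ofPred_eq, mem_univ, iff_true]
        exact hp.trans measureReal_nonneg
      rw [hdef, this]
      simp
    rw [this]
    exact measurable_const
  · have hbdd : ∀ θ, ∀ t ∈ {t | p ≤ F θ t}, 0 ≤ t := by
      intro θ t ht
      by_contra hlt
      push Not at hlt
      rw [mem_ofPred_eq, hneg θ t hlt] at ht
      linarith
    refine measurable_of_Iio fun s => ?_
    rcases le_or_gt s 0 with hs | hs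
    · have : threshold p DI ⁻¹' Iio s = ∅ := by
        ext θ
        simp only [mem_preimage, mem_Iio, mem_empty_iff_false, iff_false, not_lt]
        exact hs.trans (hdef θ ▸ Real.sInf_nonneg (hbdd θ))
      rw [this]
      exact MeasurableSet.empty
    · have : threshold p DI ⁻¹' Iio s =
          (⋃ r : {r : ℚ // (r : ℝ) < s}, {θ | p ≤ F θ r}) ∪ ⋂ n : ℕ, {θ | F θ n < p} := by
        ext θ
        simp only [mem_preimage, mem_Iio, mem_union, mem_iUnion, mem_iInter, mem_ofPred_eq]
        rw [hdef]
        constructor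
        · intro h
          by_cases hne : ({t | p ≤ F θ t}).Nonempty
          · obtain ⟨t, ht, hts⟩ := exists_lt_of_csInf_lt hne h
            obtain ⟨r, hr1, hr2⟩ := exists_rat_btwn hts
            exact Or.inl ⟨⟨r, hr2⟩, le_trans ht (hmono θ hr1.le)⟩
          · refine Or.inr fun n => ?_
            by_contra hn
            push Not at hn
            exact hne ⟨n, hn⟩
        · rintro (⟨r, hr⟩ | h)
          · exact (csInf_le ⟨0, hbdd θ⟩ hr).trans_lt r.2
          · have : {t | p ≤ F θ t} = ∅ := by
              ext t
              simp only [mem_ofPred_eq, mem_empty_iff_false, iff_false, not_le]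
              obtain ⟨n, hn⟩ := exists_nat_ge t
              exact (hmono θ hn).trans_lt (h n)
            rw [this, Real.sInf_empty]
            exact hs
      rw [this]
      exact (MeasurableSet.iUnion fun r => measurableSet_le measurable_const (hFm _)).union
        (MeasurableSet.iInter fun n => measurableSet_lt (hFm _) measurable_const)

theorem measurable_step (β p : ℝ) (Θ : ConvexBody (EuclideanSpace ℝ (Fin d)))
    (DI : Kernel (EuclideanSpace ℝ (Fin d)) (EuclideanSpace ℝ (Fin d))) [IsMarkovKernel DI] :
    Measurable (Function.uncurry (step β p Θ DI)) := by
  have hτ : Measurable fun x : EuclideanSpace ℝ (Fin d) × EuclideanSpace ℝ (Fin d) =>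
      threshold p DI x.1 := (measurable_threshold p DI).comp measurable_fst
  have hc : Measurable fun x : EuclideanSpace ℝ (Fin d) × EuclideanSpace ℝ (Fin d) =>
      clip (threshold p DI x.1) x.2 :=
    (measurable_const.min (hτ.div measurable_snd.norm)).smul measurable_snd
  exact (proj_lipschitz Θ).continuous.measurable.comp
    (measurable_fst.sub (hc.const_smul β))

/-- The transition kernel `P_{β,p}` of projected quantile-clipped SGD: from `θ`, draw an
`η`-corrupted gradient sample `g` at `θ` and move to `Π_Θ (θ - β α_θ g)`. -/
noncomputable def qcsgdKernel (η β p : ℝ) (Θ : ConvexBody (EuclideanSpace ℝ (Fin d)))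
    (DI DO : Kernel (EuclideanSpace ℝ (Fin d)) (EuclideanSpace ℝ (Fin d)))
    [IsMarkovKernel DI] [IsMarkovKernel DO] :
    Kernel (EuclideanSpace ℝ (Fin d)) (EuclideanSpace ℝ (Fin d)) where
  toFun θ := (sampleKernel η DI DO θ).map (step β p Θ DI θ)
  measurable' := by
    refine Measure.measurable_of_measurable_coe _ fun s hs => ?_
    have hm := measurable_step β p Θ DI
    have : ∀ θ, ((sampleKernel η DI DO θ).map (step β p Θ DI θ)) s =
        sampleKernel η DI DO θ (Prod.mk θ ⁻¹' (Function.uncurry (step β p Θ DI) ⁻¹' s)) :=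
      fun θ => Measure.map_apply hm.of_uncurry_left hs
    simp only [this]
    exact Kernel.measurable_kernel_prodMk_left (hm hs)

/-- The largest clipping threshold `τ̄ = sup_{θ ∈ Θ} τ_θ`. -/
noncomputable def maxThreshold (p : ℝ) (Θ : ConvexBody (EuclideanSpace ℝ (Fin d)))
    (DI : Kernel (EuclideanSpace ℝ (Fin d)) (EuclideanSpace ℝ (Fin d))) : ℝ :=
  sSup (threshold p DI '' (Θ : Set (EuclideanSpace ℝ (Fin d))))

/-- The constant `B̄ = A D + B`, with `D` the diameter of `Θ`. -/
noncomputable def boundedB (A B : ℝ) (Θ : ConvexBody (EuclideanSpace ℝ (Fin d))) : ℝ :=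
  A * Metric.diam (Θ : Set (EuclideanSpace ℝ (Fin d))) + B

end Chain

/-! Everything rests on a drift estimate for the uncorrupted gradient sample. Put u = θ - θ⋆, let w
= (1 - p)^(1 - 1/q), and write M and T for `boundedB` and `maxThreshold`. Clipping alters the sample
only on an event of probability at most 1 - p. The noise is centered, so by Hölder the bias is at
most w M ‖u‖, and strong convexity gives pμ‖u‖² - wM‖u‖ ≤ 𝔼⟨u, clip⟩ (`le_integral_inner_clip`).

The sub-exponential bound is deterministic. A clipped vector has norm at most τ_θ, so 𝔼⟨u, clip⟩ ≤
‖u‖ τ_θ. Comparing with the drift gives pμ‖u‖ ≤ τ_θ + wM on all of Θ (`HasMomentBound.norm_sub_le`).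
An invariant law lives on Θ, hence X ≤ K almost surely.

The sub-Gaussian bound is a contraction of 𝔼 exp(s²X²). Projection does not increase the distance to
θ⋆. Expanding the square and applying Hoeffding's lemma to the cross term bounds the exponent after
one step by (1 - c)s²‖u‖² + c s²K² with c = βpμ (`lintegral_exp_step_le`, `exponent_le`). Under
invariance, Jensen's inequality for the power 1 - c closes the recursion
(`integral_exp_le_of_contraction`). -/

/-! ### Quantiles of a law on the line. -/

section Quantile

variable {p : ℝ} {ν : Measure ℝ} [IsProbabilityMeasure ν]

theorem bddBelow_quantile_set (hp : 0 < p) : BddBelow {t : ℝ | p ≤ ν.real (Iic t)} := by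
  obtain ⟨a, ha⟩ := ((tendsto_cdf_atBot ν).eventually_lt_const hp).exists
  refine ⟨a, fun t ht => ?_⟩
  by_contra! hta
  have := monotone_cdf ν hta.le
  rw [mem_ofPred_eq, ← cdf_eq_real] at ht
  linarith

theorem quantile_le (hp : 0 < p) {t : ℝ} (ht : p ≤ ν.real (Iic t)) : quantile p ν ≤ t :=
  csInf_le (bddBelow_quantile_set hp) ht

/-- Right continuity of the distribution function: every point strictly above the infimum has mass
at least p to its left, and this passes to the limit. -/
theorem le_measureReal_Iic_quantile (hp1 : p < 1) :
    p ≤ ν.real (Iic (quantile p ν)) := by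
  have hne : {t : ℝ | p ≤ ν.real (Iic t)}.Nonempty := by
    obtain ⟨a, ha⟩ := ((tendsto_cdf_atTop ν).eventually_const_lt hp1).exists
    exact ⟨a, by rw [mem_ofPred_eq, ← cdf_eq_real]; exact ha.le⟩
  rw [← cdf_eq_real]
  have hr : Filter.Tendsto (cdf ν) (nhdsWithin (quantile p ν) (Ioi (quantile p ν)))
      (nhds (cdf ν (quantile p ν))) :=
    ((cdf ν).right_continuous (quantile p ν)).mono Ioi_subset_Ici_self
  refine ge_of_tendsto hr ?_
  filter_upwards [self_mem_nhdsWithin] with s hs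
  obtain ⟨t, ht, hts⟩ := exists_lt_of_csInf_lt hne hs
  rw [mem_ofPred_eq, ← cdf_eq_real] at ht
  exact ht.trans (monotone_cdf ν hts.le)

end Quantile

/-! ### Clipping as a contraction towards the origin. -/

section Clip

variable {E : Type*} [NormedAddCommGroup E] [NormedSpace ℝ E]

theorem norm_clip_le {t : ℝ} (ht : 0 ≤ t) (g : E) : ‖clip t g‖ ≤ t := by
  unfold clip
  rcases eq_or_ne g 0 with rfl | hg
  · simpa
  have hg' : 0 < ‖g‖ := norm_pos_iff.2 hg
  rw [norm_smul, Real.norm_of_nonneg (by positivity)]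
  calc min 1 (t / ‖g‖) * ‖g‖ ≤ t / ‖g‖ * ‖g‖ := by gcongr; exact min_le_right _ _
    _ = t := by field_simp

/-- The form in which clipping enters the pointwise drift estimate. At g = 0, where the quotient in
`clip` takes its default value, the factor 1 serves. -/
theorem exists_clip_eq_smul {t : ℝ} (ht : 0 ≤ t) (g : E) :
    ∃ a : ℝ, 0 ≤ a ∧ a ≤ 1 ∧ (‖g‖ ≤ t → a = 1) ∧ clip t g = a • g := by
  rcases eq_or_ne g 0 with rfl | hg
  · exact ⟨1, by simp [clip]⟩
  have hg' : 0 < ‖g‖ := norm_pos_iff.2 hg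
  refine ⟨min 1 (t / ‖g‖), by positivity, min_le_left _ _, fun h => ?_, rfl⟩
  exact min_eq_left ((one_le_div hg').2 h)

theorem measurable_clip [MeasurableSpace E] [BorelSpace E] [SecondCountableTopology E] (t : ℝ) :
    Measurable (clip t : E → E) :=
  (measurable_const.min (measurable_const.div measurable_norm)).smul measurable_id

end Clip

/-! ### Bias and exponential moments of clipped samples. -/

section Drift

variable {E : Type*} [NormedAddCommGroup E] [InnerProductSpace ℝ E] [MeasurableSpace E]
  [BorelSpace E] [SecondCountableTopology E]

/-- Clipping a centered-noise gradient sample at a level of probability `≥ p` biases it by at most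
`(1 - p) ^ (1 - 1 / q) M`. -/
theorem le_integral_inner_clip [CompleteSpace E] {P : Measure E} [IsProbabilityMeasure P] {u v : E} {p q M τ : ℝ}
    (hτ : 0 ≤ τ) (hp1 : p < 1) (hq : 1 < q) (hpτ : p ≤ P.real {g | ‖g‖ ≤ τ})
    (hint : Integrable (fun g => g - v) P) (hmean : ∫ g, (g - v) ∂P = 0)
    (hintq : Integrable (fun g => ‖g - v‖ ^ q) P)
    (hM : (∫ g, ‖g - v‖ ^ q ∂P) ^ (1 / q) ≤ M) (huv : 0 ≤ inner ℝ u v) :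
    p * inner ℝ u v - (1 - p) ^ (1 - 1 / q) * M * ‖u‖ ≤ ∫ g, inner ℝ u (clip τ g) ∂P := by
  have hS : MeasurableSet {g : E | ‖g‖ ≤ τ} := measurableSet_le measurable_norm measurable_const
  set S : Set E := {g | ‖g‖ ≤ τ}
  -- On S this is an equality. Off S the signal a⟨u, v⟩ is dropped as nonnegative, and replacing
  -- a⟨u, g - v⟩ by the full noise term, which integrates to zero, costs at most ‖u‖‖g - v‖.
  have hpoint : ∀ g, S.indicator (fun _ => inner ℝ u v) g + inner ℝ u (g - v)
      - ‖u‖ * (Sᶜ.indicator (fun _ => (1 : ℝ)) g * ‖g - v‖) ≤ inner ℝ u (clip τ g) := by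
    intro g
    obtain ⟨a, ha0, ha1, hag, hc⟩ := exists_clip_eq_smul hτ g
    have hsplit : inner ℝ u (clip τ g) = a * (inner ℝ u (g - v) + inner ℝ u v) := by
      rw [hc, inner_smul_right, ← inner_add_right, sub_add_cancel]
    rw [hsplit]
    by_cases hg : g ∈ S
    · have : g ∉ Sᶜ := fun h => h hg
      simp [hg, hag hg]
      linarith
    · have : g ∈ Sᶜ := hg
      have h1 := real_inner_le_norm u (g - v)
      have h2 : 0 ≤ ‖u‖ * ‖g - v‖ := by positivity
      simp only [indicator_of_notMem hg, indicator_of_mem this]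
      nlinarith [mul_nonneg ha0 huv, mul_le_mul_of_nonneg_left h1 (sub_nonneg.2 ha1),
        mul_nonneg ha0 h2]
  have hi1 : Integrable (S.indicator (fun _ => inner ℝ u v)) P :=
    (integrable_const _).indicator hS
  have hi2 : Integrable (fun g => inner ℝ u (g - v)) P := hint.const_inner u
  have hi3 : Integrable (fun g => Sᶜ.indicator (fun _ => (1 : ℝ)) g * ‖g - v‖) P := by
    have : (fun g => Sᶜ.indicator (fun _ => (1 : ℝ)) g * ‖g - v‖)
        = Sᶜ.indicator (fun g => ‖g - v‖) := by
      funext g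
      by_cases hg : g ∈ Sᶜ <;> simp [hg]
    rw [this]
    exact hint.norm.indicator hS.compl
  have hi4 : Integrable (fun g => inner ℝ u (clip τ g)) P := by
    refine Integrable.of_bound ((measurable_clip τ).const_inner.aestronglyMeasurable)
      (‖u‖ * τ) (Filter.Eventually.of_forall fun g => ?_)
    exact (norm_inner_le_norm _ _).trans (by gcongr; exact norm_clip_le hτ g)
  have hi12 : Integrable (fun g => S.indicator (fun _ => inner ℝ u v) g + inner ℝ u (g - v)) P :=
    hi1.add hi2
  have hmono := integral_mono (hi12.sub (hi3.const_mul ‖u‖)) hi4 hpoint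
  have hI : ∫ g, (S.indicator (fun _ => inner ℝ u v) g + inner ℝ u (g - v)
      - ‖u‖ * (Sᶜ.indicator (fun _ => (1 : ℝ)) g * ‖g - v‖)) ∂P
      = P.real S * inner ℝ u v
        - ‖u‖ * ∫ g, Sᶜ.indicator (fun _ => (1 : ℝ)) g * ‖g - v‖ ∂P := by
    rw [integral_sub hi12 (hi3.const_mul ‖u‖), integral_add hi1 hi2,
      integral_const_mul, integral_indicator_const _ hS, integral_inner hint, hmean]
    simp
  -- Hölder pairs the indicator of Sᶜ with the noise norm; powers of an indicator are the indicator
  -- itself, so its norm is P(Sᶜ)^(1 - 1/q).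
  have hconj : (Real.conjExponent q).HolderConjugate q :=
    (Real.HolderConjugate.conjExponent hq).symm
  have hexp : 1 / Real.conjExponent q = 1 - 1 / q := by
    have := hconj.inv_add_inv_eq_one
    simp only [one_div]
    linarith
  have hrpow : ∀ g, Sᶜ.indicator (fun _ => (1 : ℝ)) g ^ Real.conjExponent q
      = Sᶜ.indicator (fun _ => (1 : ℝ)) g := by
    intro g
    by_cases hg : g ∈ Sᶜ
    · simp [hg]
    · rw [indicator_of_notMem hg, Real.zero_rpow hconj.ne_zero]
  have hHolder : ∫ g, Sᶜ.indicator (fun _ => (1 : ℝ)) g * ‖g - v‖ ∂P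
      ≤ (1 - p) ^ (1 - 1 / q) * M := by
    have hq0 : 0 < q := by linarith
    have hmem : MemLp (fun g => ‖g - v‖) (ENNReal.ofReal q) P := by
      refine (integrable_norm_rpow_iff (hint.norm.aestronglyMeasurable)
        (by simpa using hq0) ENNReal.ofReal_ne_top).1 ?_
      simpa [ENNReal.toReal_ofReal hq0.le] using hintq
    refine (integral_mul_le_Lp_mul_Lq_of_nonneg hconj
      (Filter.Eventually.of_forall fun g => indicator_nonneg (fun _ _ => zero_le_one) g)
      (Filter.Eventually.of_forall fun g => norm_nonneg _)
      (memLp_indicator_const _ hS.compl 1 (Or.inr (measure_ne_top _ _))) hmem).trans ?_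
    simp only [hrpow, hexp, integral_indicator_const (1 : ℝ) hS.compl, smul_eq_mul, mul_one]
    have hc : P.real Sᶜ ≤ 1 - p := by
      rw [probReal_compl_eq_one_sub hS]
      linarith
    have he : 0 ≤ 1 - 1 / q := by
      rw [← hexp]
      exact one_div_nonneg.2 hconj.nonneg
    have h0 : 0 ≤ ∫ g, ‖g - v‖ ^ q ∂P := integral_nonneg fun g => by positivity
    gcongr
  replace hmono := hI.symm.le.trans hmono
  have h1 := mul_le_mul_of_nonneg_right hpτ huv
  have h2 := mul_le_mul_of_nonneg_left hHolder (norm_nonneg u)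
  linarith

/-- Hoeffding's lemma for the inner product with a clipped sample. -/
theorem integral_exp_inner_clip_le {P : Measure E} [IsProbabilityMeasure P] {τ : ℝ} (hτ : 0 ≤ τ)
    (u : E) (s : ℝ) :
    Integrable (fun g => Real.exp (s * inner ℝ u (clip τ g))) P ∧
    ∫ g, Real.exp (s * inner ℝ u (clip τ g)) ∂P
      ≤ Real.exp (s * ∫ g, inner ℝ u (clip τ g) ∂P + (‖u‖ * τ) ^ 2 * s ^ 2 / 2) := by
  have hm : Measurable fun g => inner ℝ u (clip τ g) := (measurable_clip τ).const_inner
  have hb : ∀ᵐ g ∂P, inner ℝ u (clip τ g) ∈ Icc (-(‖u‖ * τ)) (‖u‖ * τ) := by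
    refine Filter.Eventually.of_forall fun g => abs_le.1 ?_
    exact (abs_real_inner_le_norm _ _).trans (by gcongr; exact norm_clip_le hτ g)
  have hH := hasSubgaussianMGF_of_mem_Icc hm.aemeasurable hb
  have heq : ∀ g, Real.exp (s * inner ℝ u (clip τ g))
      = Real.exp (s * ∫ g, inner ℝ u (clip τ g) ∂P)
        * Real.exp (s * (inner ℝ u (clip τ g) - ∫ g, inner ℝ u (clip τ g) ∂P)) := by
    intro g
    rw [← Real.exp_add]
    ring_nf
  have hbound := hH.mgf_le s
  -- Hoeffding's variance proxy is the squared half-length of the interval [-‖u‖τ, ‖u‖τ].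
  have hcoe : (((‖‖u‖ * τ - -(‖u‖ * τ)‖₊ / 2) ^ 2 : NNReal) : ℝ) = (‖u‖ * τ) ^ 2 := by
    have : 0 ≤ ‖u‖ * τ := by positivity
    rw [NNReal.coe_pow, NNReal.coe_div, coe_nnnorm, Real.norm_of_nonneg (by linarith)]
    norm_num
  rw [hcoe, mgf] at hbound
  simp only [heq]
  refine ⟨(hH.integrable_exp_mul s).const_mul _, ?_⟩
  rw [integral_const_mul, Real.exp_add]
  gcongr

end Drift

/-! ### Consequences of strong convexity and smoothness. -/

section Objective

variable {d : ℕ} {𝓛 : EuclideanSpace ℝ (Fin d) → ℝ} {θstar : EuclideanSpace ℝ (Fin d)} {L μ : ℝ}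

theorem gradient_eq_zero_of_forall_le (hmin : ∀ θ, 𝓛 θstar ≤ 𝓛 θ) : ∇ 𝓛 θstar = 0 := by
  have : IsLocalMin 𝓛 θstar := Filter.Eventually.of_forall hmin
  rw [gradient, this.fderiv_eq_zero, map_zero]

/-- Sum of the two quadratic lower bounds between θ and θ⋆, the gradient vanishing at θ⋆. -/
theorem IsMuStronglyConvex.le_inner_gradient (hconvex : IsMuStronglyConvex 𝓛 μ)
    (hmin : ∀ θ, 𝓛 θstar ≤ 𝓛 θ) (θ : EuclideanSpace ℝ (Fin d)) :
    μ * ‖θ - θstar‖ ^ 2 ≤ inner ℝ (θ - θstar) (∇ 𝓛 θ) := by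
  have h1 := hconvex.2 θ θstar
  have h2 := hconvex.2 θstar θ
  rw [gradient_eq_zero_of_forall_le hmin, inner_zero_left, norm_sub_rev θstar θ] at h2
  rw [← neg_sub θ θstar, inner_neg_right, real_inner_comm] at h1
  linarith

/-- A gradient step of length 1/l from θ cannot go below the minimum, while 𝓛 θ exceeds the minimum
by at most l‖θ - θ⋆‖²/2. Taking l = max L 1 avoids any sign condition on L; the value of the
constant is immaterial, since only boundedness on Θ is needed. -/
theorem IsLSmooth.norm_gradient_le (hsmooth : IsLSmooth 𝓛 L) (hmin : ∀ θ, 𝓛 θstar ≤ 𝓛 θ)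
    (θ : EuclideanSpace ℝ (Fin d)) : ‖∇ 𝓛 θ‖ ≤ max L 1 * ‖θ - θstar‖ := by
  have hL : 0 < max L 1 := lt_of_lt_of_le one_pos (le_max_right _ _)
  have hLm := le_max_left L 1
  set l := max L 1
  have h1 := hsmooth.2 θ (θ - l⁻¹ • ∇ 𝓛 θ)
  have h2 := hsmooth.2 θstar θ
  have h3 := hmin (θ - l⁻¹ • ∇ 𝓛 θ)
  rw [gradient_eq_zero_of_forall_le hmin, inner_zero_left, norm_sub_rev θstar θ] at h2
  rw [sub_sub_cancel_left, sub_sub_cancel, inner_neg_right, inner_smul_right, norm_smul,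
    real_inner_self_eq_norm_sq, Real.norm_of_nonneg (by positivity)] at h1
  have h4 : L / 2 * (l⁻¹ * ‖∇ 𝓛 θ‖) ^ 2 ≤ l⁻¹ / 2 * ‖∇ 𝓛 θ‖ ^ 2 := by
    calc L / 2 * (l⁻¹ * ‖∇ 𝓛 θ‖) ^ 2 ≤ l / 2 * (l⁻¹ * ‖∇ 𝓛 θ‖) ^ 2 := by gcongr
      _ = l⁻¹ / 2 * ‖∇ 𝓛 θ‖ ^ 2 := by field_simp
  have h5 : L / 2 * ‖θ - θstar‖ ^ 2 ≤ l / 2 * ‖θ - θstar‖ ^ 2 := by gcongr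
  have h6 : l⁻¹ * ‖∇ 𝓛 θ‖ ^ 2 ≤ l * ‖θ - θstar‖ ^ 2 := by linarith
  refine (sq_le_sq₀ (norm_nonneg _) (by positivity)).1 ?_
  calc ‖∇ 𝓛 θ‖ ^ 2 = l * (l⁻¹ * ‖∇ 𝓛 θ‖ ^ 2) := by field_simp
    _ ≤ l * (l * ‖θ - θstar‖ ^ 2) := by gcongr
    _ = _ := by ring

end Objective

/-! ### Thresholds and drift of the gradient samples on Θ. -/

section Sample

variable {d : ℕ} {𝓛 : EuclideanSpace ℝ (Fin d) → ℝ} {θstar θ : EuclideanSpace ℝ (Fin d)}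
  {L μ p q A B : ℝ} {Θ : ConvexBody (EuclideanSpace ℝ (Fin d))}
  {DI : Kernel (EuclideanSpace ℝ (Fin d)) (EuclideanSpace ℝ (Fin d))}

theorem boundedB_pos (hA : 0 < A) (hB : 0 < B) : 0 < boundedB A B Θ := by
  have : 0 ≤ Metric.diam (Θ : Set (EuclideanSpace ℝ (Fin d))) := Metric.diam_nonneg
  unfold boundedB
  positivity

theorem norm_sub_le_diam {θ θ' : EuclideanSpace ℝ (Fin d)} (hθ : θ ∈ Θ) (hθ' : θ' ∈ Θ) :
    ‖θ - θ'‖ ≤ Metric.diam (Θ : Set (EuclideanSpace ℝ (Fin d))) := by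
  rw [← dist_eq_norm]
  exact Metric.dist_le_diam_of_mem Θ.isBounded hθ hθ'

theorem HasMomentBound.integrable (hmoment : HasMomentBound 𝓛 DI θstar q A B)
    (θ : EuclideanSpace ℝ (Fin d)) : Integrable (fun g => ‖g - ∇ 𝓛 θ‖ ^ q) (DI θ) :=
  (hmoment.2.2.2 θ).1.comp_measurable (measurable_id.sub_const _)

theorem HasMomentBound.rpow_integral_le (hmoment : HasMomentBound 𝓛 DI θstar q A B)
    (hstar : θstar ∈ Θ) (hθ : θ ∈ Θ) :
    (∫ g, ‖g - ∇ 𝓛 θ‖ ^ q ∂(DI θ)) ^ (1 / q) ≤ boundedB A B Θ := by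
  obtain ⟨-, hA, -, h⟩ := hmoment
  have h1 := (h θ).2
  have hms : Measurable fun g => g - ∇ 𝓛 θ := measurable_id.sub_const _
  rw [noiseLaw, integral_map hms.aemeasurable (h θ).1.aestronglyMeasurable] at h1
  refine h1.trans ?_
  unfold boundedB
  gcongr
  exact norm_sub_le_diam hθ hstar

theorem measureReal_map_norm (θ : EuclideanSpace ℝ (Fin d)) (t : ℝ) :
    ((DI θ).map fun g => ‖g‖).real (Iic t) = (DI θ).real {g | ‖g‖ ≤ t} := by
  rw [map_measureReal_apply measurable_norm measurableSet_Iic]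
  rfl

variable [IsMarkovKernel DI]

theorem isProbabilityMeasure_map_norm (θ : EuclideanSpace ℝ (Fin d)) :
    IsProbabilityMeasure ((DI θ).map fun g => ‖g‖) :=
  Measure.isProbabilityMeasure_map measurable_norm.aemeasurable

theorem le_measureReal_norm_le_threshold (hp1 : p < 1) (θ : EuclideanSpace ℝ (Fin d)) :
    p ≤ (DI θ).real {g | ‖g‖ ≤ threshold p DI θ} := by
  have := isProbabilityMeasure_map_norm (DI := DI) θ
  rw [← measureReal_map_norm]
  exact le_measureReal_Iic_quantile hp1

theorem threshold_nonneg (hp0 : 0 < p) (hp1 : p < 1) (θ : EuclideanSpace ℝ (Fin d)) :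
    0 ≤ threshold p DI θ := by
  by_contra! hneg
  have h := le_measureReal_norm_le_threshold (DI := DI) hp1 θ
  have : {g : EuclideanSpace ℝ (Fin d) | ‖g‖ ≤ threshold p DI θ} = ∅ := by
    ext g
    simpa using hneg.trans_le (norm_nonneg g)
  rw [this, measureReal_empty] at h
  linarith

/-- Markov's inequality at order q: the noise norm reaches M/(1 - p)^(1/q) with probability at most
1 - p, so the stated level already carries mass p. -/
theorem HasMomentBound.threshold_le (hmoment : HasMomentBound 𝓛 DI θstar q A B)
    (hp0 : 0 < p) (hp1 : p < 1) (hstar : θstar ∈ Θ) (hθ : θ ∈ Θ) :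
    threshold p DI θ ≤ ‖∇ 𝓛 θ‖ + boundedB A B Θ / (1 - p) ^ (1 / q) := by
  have hq : 0 < q := by linarith [hmoment.1]
  have hM : 0 < boundedB A B Θ := boundedB_pos hmoment.2.1 hmoment.2.2.1
  have hp : 0 < 1 - p := by linarith
  have := isProbabilityMeasure_map_norm (DI := DI) θ
  refine quantile_le hp0 ?_
  rw [measureReal_map_norm]
  set M := boundedB A B Θ
  set t := M / (1 - p) ^ (1 / q) with ht
  have htpos : 0 < t := by positivity
  have hmk := mul_meas_ge_le_integral_of_nonneg
    (Filter.Eventually.of_forall fun g => by positivity) (hmoment.integrable θ) (t ^ q)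
  have hI : ∫ g, ‖g - ∇ 𝓛 θ‖ ^ q ∂(DI θ) ≤ M ^ q := by
    have h0 : 0 ≤ ∫ g, ‖g - ∇ 𝓛 θ‖ ^ q ∂(DI θ) := integral_nonneg fun g => by positivity
    have := Real.rpow_le_rpow (by positivity) (hmoment.rpow_integral_le hstar hθ) hq.le
    rwa [← Real.rpow_mul h0, one_div_mul_cancel hq.ne', Real.rpow_one] at this
  have htq : t ^ q = M ^ q / (1 - p) := by
    rw [ht, Real.div_rpow hM.le (by positivity), ← Real.rpow_mul hp.le,
      one_div_mul_cancel hq.ne', Real.rpow_one]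
  set S := {g : EuclideanSpace ℝ (Fin d) | t ^ q ≤ ‖g - ∇ 𝓛 θ‖ ^ q}
  have hS : MeasurableSet S := measurableSet_le measurable_const (by fun_prop)
  have hSp : (DI θ).real S ≤ 1 - p := by
    have h1 : M ^ q / (1 - p) * (DI θ).real S ≤ M ^ q := htq ▸ hmk.trans hI
    have hMq : 0 < M ^ q := by positivity
    rw [div_mul_eq_mul_div, div_le_iff₀ hp] at h1
    exact le_of_mul_le_mul_left h1 hMq
  calc p ≤ (DI θ).real Sᶜ := by rw [probReal_compl_eq_one_sub hS]; linarith
    _ ≤ _ := by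
      refine measureReal_mono fun g hg => ?_
      have : ‖g - ∇ 𝓛 θ‖ < t := by
        by_contra! h
        exact hg (Real.rpow_le_rpow htpos.le h hq.le)
      have h2 := norm_add_le (∇ 𝓛 θ) (g - ∇ 𝓛 θ)
      rw [add_sub_cancel] at h2
      rw [mem_ofPred_eq]
      linarith

/-- The content is that thresholds are bounded on Θ; otherwise the real `sSup` would be a default
value rather than an upper bound. -/
theorem HasMomentBound.threshold_le_maxThreshold (hmoment : HasMomentBound 𝓛 DI θstar q A B)
    (hsmooth : IsLSmooth 𝓛 L) (hmin : ∀ θ, 𝓛 θstar ≤ 𝓛 θ) (hp0 : 0 < p) (hp1 : p < 1)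
    (hstar : θstar ∈ Θ) (hθ : θ ∈ Θ) : threshold p DI θ ≤ maxThreshold p Θ DI := by
  refine le_csSup ⟨max L 1 * Metric.diam (Θ : Set (EuclideanSpace ℝ (Fin d)))
    + boundedB A B Θ / (1 - p) ^ (1 / q), ?_⟩ (mem_image_of_mem _ hθ)
  rintro _ ⟨θ', hθ', rfl⟩
  refine (hmoment.threshold_le hp0 hp1 hstar hθ').trans ?_
  gcongr
  refine (hsmooth.norm_gradient_le hmin θ').trans ?_
  gcongr
  exact norm_sub_le_diam hθ' hstar

/-- The drift of the clipped gradient samples towards the minimizer. -/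
theorem HasMomentBound.le_integral_inner_clip (hmoment : HasMomentBound 𝓛 DI θstar q A B)
    (hdiffuse : IsCenteredDiffuse 𝓛 DI) (hconvex : IsMuStronglyConvex 𝓛 μ)
    (hmin : ∀ θ, 𝓛 θstar ≤ 𝓛 θ) (hp0 : 0 < p) (hp1 : p < 1) (hstar : θstar ∈ Θ) (hθ : θ ∈ Θ) :
    p * μ * ‖θ - θstar‖ ^ 2 - (1 - p) ^ (1 - 1 / q) * boundedB A B Θ * ‖θ - θstar‖
      ≤ ∫ g, inner ℝ (θ - θstar) (clip (threshold p DI θ) g) ∂(DI θ) := by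
  have hinner := hconvex.le_inner_gradient hmin θ
  have hμ := hconvex.1
  obtain ⟨hint, hmean⟩ := hdiffuse.1 θ
  have hms : Measurable fun g => g - ∇ 𝓛 θ := measurable_id.sub_const _
  rw [noiseLaw, integral_map hms.aemeasurable hint.aestronglyMeasurable] at hmean
  have h := _root_.le_integral_inner_clip (P := DI θ) (u := θ - θstar)
    (threshold_nonneg hp0 hp1 θ) hp1 hmoment.1
    (le_measureReal_norm_le_threshold hp1 θ) (hint.comp_measurable hms) hmean
    (hmoment.integrable θ) (hmoment.rpow_integral_le hstar hθ)
    (le_trans (by positivity) hinner)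
  refine le_trans ?_ h
  have := mul_le_mul_of_nonneg_left hinner hp0.le
  linarith

/-- The drift is at most the clipping level, which bounds the distance to the minimizer. -/
theorem HasMomentBound.norm_sub_le (hmoment : HasMomentBound 𝓛 DI θstar q A B)
    (hdiffuse : IsCenteredDiffuse 𝓛 DI) (hconvex : IsMuStronglyConvex 𝓛 μ)
    (hmin : ∀ θ, 𝓛 θstar ≤ 𝓛 θ) (hp0 : 0 < p) (hp1 : p < 1) (hstar : θstar ∈ Θ) (hθ : θ ∈ Θ) :
    ‖θ - θstar‖ ≤ (threshold p DI θ + (1 - p) ^ (1 - 1 / q) * boundedB A B Θ) / (p * μ) := by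
  have hμ := hconvex.1
  have hτ := threshold_nonneg (DI := DI) hp0 hp1 θ
  have hM : 0 < boundedB A B Θ := boundedB_pos hmoment.2.1 hmoment.2.2.1
  have hp : 0 < 1 - p := by linarith
  have h1 := hmoment.le_integral_inner_clip hdiffuse hconvex hmin hp0 hp1 hstar hθ
  have h2 : ∫ g, inner ℝ (θ - θstar) (clip (threshold p DI θ) g) ∂(DI θ)
      ≤ ‖θ - θstar‖ * threshold p DI θ := by
    have := norm_integral_le_of_norm_le_const (μ := DI θ)
      (f := fun g => inner ℝ (θ - θstar) (clip (threshold p DI θ) g))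
      (C := ‖θ - θstar‖ * threshold p DI θ) (Filter.Eventually.of_forall fun g =>
        (norm_inner_le_norm _ _).trans (by gcongr; exact norm_clip_le hτ g))
    rw [probReal_univ, mul_one] at this
    exact (le_abs_self _).trans this
  rw [le_div_iff₀ (by positivity)]
  -- Both sides of the drift comparison carry a factor ‖θ - θ⋆‖, cancelled when positive.
  rcases (norm_nonneg (θ - θstar)).eq_or_lt with h0 | h0
  · rw [← h0, zero_mul]
    positivity
  · refine le_of_mul_le_mul_left ?_ h0
    nlinarith

end Sample

/-! ### Projection and invariant laws. -/

section Invariant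

variable {d : ℕ} {θstar : EuclideanSpace ℝ (Fin d)} {η β p : ℝ}
  {Θ : ConvexBody (EuclideanSpace ℝ (Fin d))}
  {DI DO : Kernel (EuclideanSpace ℝ (Fin d)) (EuclideanSpace ℝ (Fin d))}
  [IsMarkovKernel DI] [IsMarkovKernel DO] {π : Measure (EuclideanSpace ℝ (Fin d))}

theorem proj_eq_self (hstar : θstar ∈ Θ) : proj Θ θstar = θstar := by
  have h := proj_inner_le Θ θstar θstar hstar
  rw [real_inner_self_eq_norm_sq] at h
  have : ‖θstar - proj Θ θstar‖ = 0 := by nlinarith [norm_nonneg (θstar - proj Θ θstar)]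
  exact (sub_eq_zero.1 (norm_eq_zero.1 this)).symm

theorem norm_proj_sub_le (hstar : θstar ∈ Θ) (x : EuclideanSpace ℝ (Fin d)) :
    ‖proj Θ x - θstar‖ ≤ ‖x - θstar‖ := by
  have h := (proj_lipschitz Θ).dist_le_mul x θstar
  rwa [proj_eq_self hstar, NNReal.coe_one, one_mul, dist_eq_norm, dist_eq_norm] at h

/-- Every transition ends with a projection, so one step from any point already lands in Θ. -/
theorem ae_mem_of_invariant (hπ : (qcsgdKernel η β p Θ DI DO).Invariant π) :
    ∀ᵐ θ ∂π, θ ∈ Θ := by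
  have hm : MeasurableSet (Θ : Set (EuclideanSpace ℝ (Fin d)))ᶜ :=
    Θ.isClosed.measurableSet.compl
  have : π (Θ : Set (EuclideanSpace ℝ (Fin d)))ᶜ = 0 := by
    rw [← hπ.def, Measure.bind_apply hm (Kernel.aemeasurable _)]
    refine (lintegral_congr fun θ => ?_).trans lintegral_zero
    change ((sampleKernel η DI DO θ).map (step β p Θ DI θ)) _ = 0
    rw [Measure.map_apply (measurable_step β p Θ DI).of_uncurry_left hm]
    refine (measure_mono_null (t := ∅) ?_ measure_empty)
    intro g hg
    exact hg (proj_mem Θ _)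
  exact this

theorem lintegral_of_invariant_zero (hπ : (qcsgdKernel 0 β p Θ DI DO).Invariant π)
    {f : EuclideanSpace ℝ (Fin d) → ℝ≥0∞} (hf : Measurable f) :
    ∫⁻ θ, f θ ∂π = ∫⁻ θ, ∫⁻ g, f (step β p Θ DI θ g) ∂(DI θ) ∂π := by
  conv_lhs => rw [← hπ.def]
  rw [Measure.lintegral_bind (Kernel.aemeasurable _) hf.aemeasurable]
  refine lintegral_congr fun θ => ?_
  change ∫⁻ x, f x ∂((sampleKernel 0 DI DO θ).map (step β p Θ DI θ)) = _
  have hs : sampleKernel 0 DI DO θ = DI θ := by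
    change ENNReal.ofReal 0 • DO θ + ENNReal.ofReal (1 - 0) • DI θ = DI θ
    simp
  rw [lintegral_map hf (measurable_step β p Θ DI).of_uncurry_left, hs]

end Invariant

/-! ### One-step bound and contraction of exponential moments. -/

section SubGaussian

variable {d : ℕ} {θstar : EuclideanSpace ℝ (Fin d)} {β p : ℝ}
  {Θ : ConvexBody (EuclideanSpace ℝ (Fin d))}
  {DI DO : Kernel (EuclideanSpace ℝ (Fin d)) (EuclideanSpace ℝ (Fin d))}
  [IsMarkovKernel DI] [IsMarkovKernel DO] {π : Measure (EuclideanSpace ℝ (Fin d))}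

/-- One step of the uncorrupted chain, for the exponential of the squared distance. -/
theorem lintegral_exp_step_le {θ : EuclideanSpace ℝ (Fin d)} {S T m : ℝ} (hstar : θstar ∈ Θ)
    (hτ : 0 ≤ threshold p DI θ) (hT : threshold p DI θ ≤ T) (hS : 0 ≤ S) (hβ : 0 < β)
    (hm : m ≤ ∫ g, inner ℝ (θ - θstar) (clip (threshold p DI θ) g) ∂(DI θ)) :
    ∫⁻ g, ENNReal.ofReal (Real.exp (S * ‖step β p Θ DI θ g - θstar‖ ^ 2)) ∂(DI θ)
      ≤ ENNReal.ofReal (Real.exp (S * (‖θ - θstar‖ ^ 2 - 2 * β * m + β ^ 2 * T ^ 2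
        + 2 * β ^ 2 * S * ‖θ - θstar‖ ^ 2 * T ^ 2))) := by
  set τ := threshold p DI θ
  set u := θ - θstar
  -- The parameter -2βS is the coefficient of ⟨u, clip⟩ in S‖u - β clip‖²; Hoeffding's term is then
  -- 2β²S²‖u‖²τ².
  obtain ⟨hint, hle⟩ := integral_exp_inner_clip_le (P := DI θ) hτ u (-(2 * β * S))
  have hτT : τ ^ 2 ≤ T ^ 2 := by gcongr
  have hpoint : ∀ g, Real.exp (S * ‖step β p Θ DI θ g - θstar‖ ^ 2)
      ≤ Real.exp (S * (‖u‖ ^ 2 + β ^ 2 * T ^ 2))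
        * Real.exp (-(2 * β * S) * inner ℝ u (clip τ g)) := by
    intro g
    rw [← Real.exp_add, Real.exp_le_exp]
    have h1 : ‖step β p Θ DI θ g - θstar‖ ^ 2 ≤ ‖u - β • clip τ g‖ ^ 2 := by
      have := norm_proj_sub_le hstar (θ - β • clip τ g)
      rw [sub_right_comm] at this
      have h0 : ‖step β p Θ DI θ g - θstar‖ ≤ ‖u - β • clip τ g‖ := this
      gcongr
    have h2 : ‖clip τ g‖ ^ 2 ≤ T ^ 2 := by
      have := (norm_clip_le hτ g).trans hT
      gcongr
    rw [norm_sub_sq_real u, inner_smul_right, norm_smul, Real.norm_of_nonneg hβ.le] at h1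
    have h3 : ‖step β p Θ DI θ g - θstar‖ ^ 2
        ≤ ‖u‖ ^ 2 - 2 * β * inner ℝ u (clip τ g) + β ^ 2 * T ^ 2 := by
      have : β ^ 2 * ‖clip τ g‖ ^ 2 ≤ β ^ 2 * T ^ 2 := by gcongr
      linarith
    have := mul_le_mul_of_nonneg_left h3 hS
    linarith
  calc ∫⁻ g, ENNReal.ofReal (Real.exp (S * ‖step β p Θ DI θ g - θstar‖ ^ 2)) ∂(DI θ)
      ≤ ∫⁻ g, ENNReal.ofReal (Real.exp (S * (‖u‖ ^ 2 + β ^ 2 * T ^ 2))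
        * Real.exp (-(2 * β * S) * inner ℝ u (clip τ g))) ∂(DI θ) :=
        lintegral_mono fun g => ENNReal.ofReal_le_ofReal (hpoint g)
    _ = ENNReal.ofReal (∫ g, Real.exp (S * (‖u‖ ^ 2 + β ^ 2 * T ^ 2))
        * Real.exp (-(2 * β * S) * inner ℝ u (clip τ g)) ∂(DI θ)) :=
        (ofReal_integral_eq_lintegral_ofReal (hint.const_mul _)
          (Filter.Eventually.of_forall fun g => by positivity)).symm
    _ ≤ _ := by
        refine ENNReal.ofReal_le_ofReal ?_
        rw [integral_const_mul]
        refine (mul_le_mul_of_nonneg_left hle (Real.exp_pos _).le).trans ?_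
        rw [← Real.exp_add, Real.exp_le_exp]
        have h1 := mul_le_mul_of_nonneg_left hm (by positivity : 0 ≤ 2 * β * S)
        have h2 : 2 * β ^ 2 * S ^ 2 * ‖u‖ ^ 2 * τ ^ 2 ≤ 2 * β ^ 2 * S ^ 2 * ‖u‖ ^ 2 * T ^ 2 := by
          gcongr
        linarith

/-- A variable whose exponential moment contracts at rate `1 - c` up to `exp (c b)` has
exponential moment at most `exp b`. -/
theorem integral_exp_le_of_contraction {Ω : Type*} [MeasurableSpace Ω] {P : Measure Ω}
    [IsProbabilityMeasure P] {Y : Ω → ℝ} {c b C : ℝ} (hY : Measurable Y) (hc0 : 0 < c)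
    (hc1 : c ≤ 1) (hYC : ∀ᵐ ω ∂P, |Y ω| ≤ C)
    (h : ∫⁻ ω, ENNReal.ofReal (Real.exp (Y ω)) ∂P
      ≤ ∫⁻ ω, ENNReal.ofReal (Real.exp ((1 - c) * Y ω + c * b)) ∂P) :
    Integrable (fun ω => Real.exp (Y ω)) P ∧ ∫ ω, Real.exp (Y ω) ∂P ≤ Real.exp b := by
  have hint : Integrable (fun ω => Real.exp (Y ω)) P := by
    refine Integrable.of_bound hY.exp.aestronglyMeasurable (Real.exp C) ?_
    filter_upwards [hYC] with ω hω
    rw [Real.norm_of_nonneg (Real.exp_pos _).le]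
    exact Real.exp_le_exp.2 ((le_abs_self _).trans hω)
  have hint' : Integrable (fun ω => Real.exp (Y ω) ^ (1 - c)) P := by
    refine Integrable.of_bound (hY.exp.pow_const _).aestronglyMeasurable (Real.exp C ^ (1 - c)) ?_
    filter_upwards [hYC] with ω hω
    rw [Real.norm_of_nonneg (by positivity)]
    exact Real.rpow_le_rpow (Real.exp_pos _).le
      (Real.exp_le_exp.2 ((le_abs_self _).trans hω)) (by linarith)
  refine ⟨hint, ?_⟩
  have heq : ∀ ω, Real.exp ((1 - c) * Y ω + c * b)
      = Real.exp (c * b) * Real.exp (Y ω) ^ (1 - c) := by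
    intro ω
    rw [← Real.exp_mul, ← Real.exp_add]
    ring_nf
  have hpos : ∀ ω, 0 ≤ Real.exp (c * b) * Real.exp (Y ω) ^ (1 - c) := fun ω => by positivity
  simp only [heq] at h
  rw [← ofReal_integral_eq_lintegral_ofReal hint
    (Filter.Eventually.of_forall fun ω => (Real.exp_pos _).le),
    ← ofReal_integral_eq_lintegral_ofReal (hint'.const_mul _) (Filter.Eventually.of_forall hpos),
    ENNReal.ofReal_le_ofReal_iff (integral_nonneg hpos), integral_const_mul] at h
  -- Jensen for the concave power 1 - c. It leads to M ≤ exp(cb) M^(1 - c), and finiteness of M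
  -- allows solving for log M.
  have hJ : ∫ ω, Real.exp (Y ω) ^ (1 - c) ∂P ≤ (∫ ω, Real.exp (Y ω) ∂P) ^ (1 - c) :=
    (Real.concaveOn_rpow (by linarith) (by linarith)).le_map_integral
      (Real.continuous_rpow_const (by linarith)).continuousOn isClosed_Ici
      (Filter.Eventually.of_forall fun ω => (Real.exp_pos (Y ω)).le) hint hint'
  have hM : 0 < ∫ ω, Real.exp (Y ω) ∂P := integral_exp_pos hint
  set M := ∫ ω, Real.exp (Y ω) ∂P
  have h1 : M ≤ Real.exp (c * b) * M ^ (1 - c) :=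
    h.trans (mul_le_mul_of_nonneg_left hJ (Real.exp_pos _).le)
  have h2 := Real.log_le_log hM h1
  rw [Real.log_mul (Real.exp_pos _).ne' (by positivity), Real.log_exp, Real.log_rpow hM] at h2
  rw [← Real.log_le_iff_le_exp hM]
  refine le_of_mul_le_mul_left ?_ hc0
  linarith

end SubGaussian

/-! ### Numerical consequences of the step-size and quantile conditions. -/

section Constants

variable {μ L q A p β : ℝ}

/-- Without corruption κ ≤ μ, so β(μ² + 6L²) < μ/4. -/
theorem mul_le_quarter_of_lt_kappa (hμ : 0 < μ) (hA : 0 < A) (hp1 : p < 1)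
    (hβ : β < 1 / 4 * (kappa 0 p μ L q A / (μ ^ 2 + 6 * L ^ 2))) : β * μ ≤ 1 / 4 := by
  have hp : 0 < 1 - p := by linarith
  have h1 : 0 ≤ (1 - p) ^ (-1 / q) * A * (1 - p) := by positivity
  have hκ : kappa 0 p μ L q A ≤ μ := by
    unfold kappa
    nlinarith
  have hden : 0 < μ ^ 2 + 6 * L ^ 2 := by positivity
  rw [← mul_div_assoc, lt_div_iff₀ hden] at hβ
  by_contra! hlt
  have h2 : 0 < β := pos_of_mul_pos_left (by linarith) hμ.le
  have h3 : 1 / 4 * μ < β * μ * μ := by gcongr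
  nlinarith [mul_nonneg h2.le (sq_nonneg L)]

theorem half_le_of_one_sub_rpow_le (hq : 1 < q) (hβμ : 0 < β * μ) (hβμ' : β * μ ≤ 1 / 4)
    (hp : 1 - (β * μ) ^ (q / (2 * (q - 1))) ≤ p) : 1 / 2 ≤ p := by
  have hexp : 1 / 2 ≤ q / (2 * (q - 1)) := by
    rw [div_le_div_iff₀ (by norm_num) (by linarith)]
    linarith
  have h1 : (β * μ) ^ (q / (2 * (q - 1))) ≤ (β * μ) ^ (1 / 2 : ℝ) :=
    Real.rpow_le_rpow_of_exponent_ge hβμ (by linarith) hexp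
  rw [← Real.sqrt_eq_rpow] at h1
  have h2 : √(β * μ) ≤ 1 / 2 := Real.sqrt_le_iff.2 ⟨by norm_num, by norm_num; linarith⟩
  linarith

/-- The exponents q/(2(q - 1)) and 1 - 1/q multiply to 1/2: the condition on p makes the clipping
bias of order √(βμ). -/
theorem sq_one_sub_rpow_le (hq : 1 < q) (hβμ : 0 < β * μ) (hp1 : p < 1)
    (hp : 1 - (β * μ) ^ (q / (2 * (q - 1))) ≤ p) : ((1 - p) ^ (1 - 1 / q)) ^ 2 ≤ β * μ := by
  have hp' : 0 < 1 - p := by linarith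
  have he : 0 ≤ 1 - 1 / q := by
    rw [sub_nonneg, div_le_one (by linarith)]
    exact hq.le
  have h1 : (1 - p) ^ (1 - 1 / q) ≤ ((β * μ) ^ (q / (2 * (q - 1)))) ^ (1 - 1 / q) :=
    Real.rpow_le_rpow hp'.le (by linarith) he
  have hmul : q / (2 * (q - 1)) * (1 - 1 / q) = 1 / 2 := by
    have : q - 1 ≠ 0 := by linarith
    have : q ≠ 0 := by linarith
    field_simp
  rw [← Real.rpow_mul hβμ.le, hmul, ← Real.sqrt_eq_rpow] at h1
  calc ((1 - p) ^ (1 - 1 / q)) ^ 2 ≤ √(β * μ) ^ 2 := by gcongr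
    _ = β * μ := Real.sq_sqrt hβμ.le

/-- The exponent after one step, with rate `β p μ` and level `32 β (M² + T²) / (p μ)`. -/
theorem exponent_le {x w M T S : ℝ} (hμ : 0 < μ) (hp : 1 / 2 ≤ p) (hβ : 0 < β)
    (hw : w ^ 2 ≤ β * μ) (hS : S * (32 * β * (M ^ 2 + T ^ 2)) ≤ p * μ) (hS0 : 0 ≤ S) :
    x ^ 2 - 2 * β * (p * μ * x ^ 2 - w * M * x) + β ^ 2 * T ^ 2
        + 2 * β ^ 2 * S * x ^ 2 * T ^ 2
      ≤ (1 - β * p * μ) * x ^ 2 + 32 * β ^ 2 * (M ^ 2 + T ^ 2) := by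
  -- The range of S lets the drift absorb Hoeffding's variance term.
  have h1 : 2 * β ^ 2 * S * x ^ 2 * T ^ 2 ≤ β * (p * μ) * x ^ 2 / 16 := by
    have : S * (32 * β * T ^ 2) ≤ p * μ := by
      have : 0 ≤ S * (32 * β * M ^ 2) := by positivity
      linarith
    have := mul_le_mul_of_nonneg_left this (by positivity : 0 ≤ β * x ^ 2 / 16)
    linarith
  -- Weighted AM-GM splits the bias. As p ≥ 1/2, the part μx²/4 is at most half of pμx², so the rate
  -- left, 2 - 1/2 - 1/16 in units of βpμ, exceeds 1.
  have h2 : 2 * (w * M * x) ≤ μ / 4 * x ^ 2 + 4 * β * M ^ 2 := by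
    have h3 : w ^ 2 * M ^ 2 ≤ β * μ * M ^ 2 := by gcongr
    have h4 : 0 ≤ (μ * x - 4 * (w * M)) ^ 2 := sq_nonneg _
    refine le_of_mul_le_mul_left ?_ hμ
    nlinarith
  have h5 := mul_le_mul_of_nonneg_left h2 hβ.le
  have h6 : β * (1 / 2 * μ * x ^ 2) ≤ β * (p * μ * x ^ 2) := by gcongr
  nlinarith [sq_nonneg (β * M), sq_nonneg (β * T)]

end Constants

/-! ### The concentration theorem. -/

theorem proposition3 {d : ℕ}
    (𝓛 : EuclideanSpace ℝ (Fin d) → ℝ) (θstar : EuclideanSpace ℝ (Fin d))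
    (L μ q A B η p β : ℝ)
    (Θ : ConvexBody (EuclideanSpace ℝ (Fin d)))
    (DI DO : Kernel (EuclideanSpace ℝ (Fin d)) (EuclideanSpace ℝ (Fin d)))
    [IsMarkovKernel DI] [IsMarkovKernel DO]
    -- smooth, strongly convex objective whose minimizer lies in `Θ`
    (hsmooth : IsLSmooth 𝓛 L) (hconvex : IsMuStronglyConvex 𝓛 μ)
    (hmin : ∀ θ, 𝓛 θstar ≤ 𝓛 θ) (hmem : θstar ∈ Θ)
    -- uncorrupted gradient samples: unbiased, diffuse, with a moment of order `q`
    (hdiffuse : IsCenteredDiffuse 𝓛 DI) (hmoment : HasMomentBound 𝓛 DI θstar q A B)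
    -- corruption rate, quantile and step size
    (hη0 : 0 ≤ η) (hη : η < 1 / 2) (hp0 : 0 < p) (hp1 : p < 1) (hpη : p ∈ Icc η (1 - η))
    (hκ : 0 < kappa η p μ L q A) (hβ : 0 < β)
    -- an invariant distribution of the chain
    (π : Measure (EuclideanSpace ℝ (Fin d))) [IsProbabilityMeasure π]
    (hπ : (qcsgdKernel η β p Θ DI DO).Invariant π) :
    (η = 0 →
      β < 1 / 4 * (kappa η p μ L q A / (μ ^ 2 + 6 * L ^ 2)) →
      1 - (β * μ) ^ (q / (2 * (q - 1))) ≤ p →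
      IsSubGaussian
        (4 * Real.sqrt (2 * β * (boundedB A B Θ ^ 2 + maxThreshold p Θ DI ^ 2) / (p * μ)))
        (fun θ => ‖θ - θstar‖) π) ∧
    (0 < η →
      β < 1 / 4 * (kappa η p μ L q A / (μ ^ 2 + 6 * L ^ 2 + 16 * η ^ (-2 / q) * A ^ 2)) →
      IsSubExponential
        ((7 * maxThreshold p Θ DI + (1 - p) ^ (1 - 1 / q) * boundedB A B Θ) / (p * μ))
        (fun θ => ‖θ - θstar‖) π) := by
  have hμ := hconvex.1
  have hq := hmoment.1
  have hM : 0 < boundedB A B Θ := boundedB_pos hmoment.2.1 hmoment.2.2.1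
  have hmemΘ := ae_mem_of_invariant hπ
  have hp : 0 < 1 - p := by linarith
  have hτ : ∀ θ ∈ Θ, threshold p DI θ ≤ maxThreshold p Θ DI := fun θ hθ =>
    hmoment.threshold_le_maxThreshold hsmooth hmin hp0 hp1 hmem hθ
  have hT : 0 ≤ maxThreshold p Θ DI :=
    (threshold_nonneg hp0 hp1 θstar).trans (hτ θstar hmem)
  refine ⟨?_, fun _ _ => ?_⟩
  · rintro rfl hβ' hpβ
    have hβμ := mul_le_quarter_of_lt_kappa hμ hmoment.2.1 hp1 hβ'
    have hβμ0 : 0 < β * μ := by positivity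
    have hhalf := half_le_of_one_sub_rpow_le hq hβμ0 hβμ hpβ
    have hw := sq_one_sub_rpow_le hq hβμ0 hp1 hpβ
    set M := boundedB A B Θ
    set T := maxThreshold p Θ DI
    have hpos : 0 < 2 * β * (M ^ 2 + T ^ 2) / (p * μ) := by positivity
    have hK : 0 < 4 * √(2 * β * (M ^ 2 + T ^ 2) / (p * μ)) := by positivity
    have hKsq : (4 * √(2 * β * (M ^ 2 + T ^ 2) / (p * μ))) ^ 2
        = 32 * β * (M ^ 2 + T ^ 2) / (p * μ) := by
      rw [mul_pow, Real.sq_sqrt hpos.le]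
      ring
    refine ⟨hK, fun s hs => ?_⟩
    set K := 4 * √(2 * β * (M ^ 2 + T ^ 2) / (p * μ))
    have hsK : s ^ 2 * (32 * β * (M ^ 2 + T ^ 2)) ≤ p * μ := by
      have h1 : s ^ 2 * K ^ 2 ≤ 1 := by
        rw [← mul_pow, sq_le_one_iff_abs_le_one, abs_mul, abs_of_pos hK]
        exact (le_div_iff₀ hK).1 hs
      rw [hKsq, ← mul_div_assoc, div_le_one (by positivity)] at h1
      exact h1
    -- K² is the fixed point of the one-step recursion: additive term divided by the rate βpμ.
    have hcK : β * p * μ * K ^ 2 = 32 * β ^ 2 * (M ^ 2 + T ^ 2) := by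
      rw [hKsq]
      field_simp
    have hYm : Measurable fun θ : EuclideanSpace ℝ (Fin d) => s ^ 2 * ‖θ - θstar‖ ^ 2 := by
      fun_prop
    refine integral_exp_le_of_contraction (c := β * p * μ)
      (C := s ^ 2 * Metric.diam (Θ : Set (EuclideanSpace ℝ (Fin d))) ^ 2)
      hYm (by positivity) (by nlinarith) ?_ ?_
    · filter_upwards [hmemΘ] with θ hθ
      rw [abs_of_nonneg (by positivity)]
      gcongr
      exact norm_sub_le_diam hθ hmem
    · rw [lintegral_of_invariant_zero hπ hYm.exp.ennreal_ofReal]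
      refine lintegral_mono_ae ?_
      filter_upwards [hmemΘ] with θ hθ
      refine (lintegral_exp_step_le hmem (threshold_nonneg hp0 hp1 θ) (hτ θ hθ) (sq_nonneg s) hβ
        (hmoment.le_integral_inner_clip hdiffuse hconvex hmin hp0 hp1 hmem hθ)).trans ?_
      refine ENNReal.ofReal_le_ofReal (Real.exp_le_exp.2 ?_)
      have h := mul_le_mul_of_nonneg_left
        (exponent_le (x := ‖θ - θstar‖) hμ hhalf hβ hw hsK (sq_nonneg s)) (sq_nonneg s)
      refine h.trans (le_of_eq ?_)
      rw [← hcK]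
      ring
  · set K := (7 * maxThreshold p Θ DI + (1 - p) ^ (1 - 1 / q) * boundedB A B Θ) / (p * μ)
      with hKdef
    have hK : 0 < K := by positivity
    have hX : ∀ᵐ θ ∂π, ‖θ - θstar‖ ≤ K := by
      filter_upwards [hmemΘ] with θ hθ
      refine (hmoment.norm_sub_le hdiffuse hconvex hmin hp0 hp1 hmem hθ).trans ?_
      rw [hKdef]
      gcongr
      -- The comparison needs the largest threshold once; its nonnegativity allows the factor 7.
      linarith [hτ θ hθ]
    refine ⟨hK, fun s hs _ => ?_⟩
    have hle : ∀ᵐ θ ∂π, Real.exp (s * |‖θ - θstar‖|) ≤ Real.exp (s * K) := by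
      filter_upwards [hX] with θ hθ
      rw [abs_norm]
      gcongr
    have hint : Integrable (fun θ => Real.exp (s * |‖θ - θstar‖|)) π := by
      refine Integrable.of_bound (by fun_prop) (Real.exp (s * K)) ?_
      filter_upwards [hle] with θ hθ
      rwa [Real.norm_of_nonneg (Real.exp_pos _).le]
    refine ⟨hint, (integral_mono_ae hint (integrable_const _) hle).trans ?_⟩
    simp
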